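/- Let $d\ge 1$, let $X_{free}\subset\mathbb R^d$ be Borel measurable with $0<\mathrm{vol}(X_{free})<\infty$, and for $r>0$ write $\mathbb P(B_r^d)=\mathrm{vol}(B_r^d)/\mathrm{vol}(X_{free})$, where $B_r^d$ is a Euclidean ball of radius $r$ in $\mathbb R^d$. Call a continuous path $\sigma:[0,1]\to\mathbb R^d$ $\delta$-clear if $B_\delta^d(\sigma(t))\subset X_{free}$ for all $t$. The $K$-nearest-neighbor (KNN) PRM on a finite set $N\subset\mathbb R^d$ is the undirected graph on $N$ in which every $v\in N$ is joined to each of its $K$ nearest neighbors $u$ in $N\setminus\{v\}$ for which the segment from $u$ to $v$ lies in $X_{free}$ (to all other points, if there are fewer than $K$); to answer a query $(x_s,x_g)$, each of $x_s$ and $x_g$ is joined in the same way to its $K$ nearest neighbors in $N$, and a shortest path from $x_s$ to $x_g$ in the resulting graph, with edges weighted by Euclidean length, is returned if there is one. Let $n\ge 2$, $K\ge 0$ be integers, $\alpha>0$, $\gamma\in(0,1)$, and let $N$ be a set of $n$ i.i.d. uniform random samples of $X_{free}$. Suppose that $$n\ \ge\ \max\left\{\frac{4}{\mathbb P(B_\alpha^d)}\log_2\frac4\gamma,\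 \frac{8d}{\mathbb P(B_\alpha^d)}\log_2\frac{13}{\mathbb P(B_\alpha^d)}\right\},$$ that $K\ge\sqrt{2K\log(2n/\gamma)}$ (natural logarithm), and that $$\alpha\ \le\ \frac14\left[\frac{K-\sqrt{2K\log(2n/\gamma)}}{(n-1)\,\mathbb P(B_1^d)}\right]^{1/d}.$$ Then, with probability at least $1-\gamma$, the following holds for all $x_s,x_g\in X_{free}$ simultaneously and however ties between neighbors are broken: if there is a $2\alpha$-clear path from $x_s$ to $x_g$, then the KNN PRM on $N$ returns a feasible path from $x_s$ to $x_g$, that is, a path contained in $X_{free}$. -/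

import Mathlib

open MeasureTheory ProbabilityTheory

namespace KnnPrm

/-- The configuration space is a subset of `ℝᵈ` with the Euclidean norm. -/
abbrev Conf (d : ℕ) := EuclideanSpace ℝ (Fin d)

/-- `ℙ(B_r^d)`: the volume of a `d`-dimensional ball of radius `r`, relative to the volume of the
free space. The ball is not intersected with the free space, so the value does not depend on
where the ball is located. -/
noncomputable def ballProb {d : ℕ} (Xfree : Set (Conf d)) (r : ℝ) : ℝ :=
  (volume (Metric.closedBall (0 : Conf d) r)).toReal / (volume Xfree).toReal

/-- A continuous path `σ` is `δ`-clear if `B_δ(σ(t)) ⊆ Xfree` for all `t`. -/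
def IsClear {d : ℕ} (Xfree : Set (Conf d)) (δ : ℝ) {s g : Conf d} (σ : Path s g) : Prop :=
  ∀ t, Metric.ball (σ t) δ ⊆ Xfree

/-- `U` is a set of `K` nearest neighbors of `v` in the finite set `S` (all of `S` if `S` has fewer
than `K` elements); ties may be broken in any way. -/
def IsKNearest {d : ℕ} (K : ℕ) (v : Conf d) (S U : Finset (Conf d)) : Prop :=
  U ⊆ S ∧ U.card = min K S.card ∧ ∀ u ∈ U, ∀ w ∈ S, w ∉ U → dist v u ≤ dist v w

/-- A `K`-nearest-neighbor search routine: `near v S` is a set of `K` nearest neighbors of `v`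
in `S`. -/
def IsKNearSearch {d : ℕ} (K : ℕ) (near : Conf d → Finset (Conf d) → Finset (Conf d)) : Prop :=
  ∀ v S, IsKNearest K v S (near v S)

/-- The straight line between `u` and `v` is collision-free. -/
def CollisionFree {d : ℕ} (Xfree : Set (Conf d)) (u v : Conf d) : Prop :=
  segment ℝ u v ⊆ Xfree

open Classical in
/-- The roadmap built on the vertex set `V`: every `v ∈ V` is joined to each
`u ∈ near v (V \ {v})` for which the straight line from `v` to `u` is collision-free
(`SimpleGraph.fromRel` makes the relation symmetric). Points outside `V` are isolated. -/
def roadmap {d : ℕ} (Xfree : Set (Conf d)) (near : Conf d → Finset (Conf d) → Finset (Conf d))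
    (V : Finset (Conf d)) : SimpleGraph (Conf d) :=
  SimpleGraph.fromRel fun v u => v ∈ V ∧ u ∈ near v (V.erase v) ∧ CollisionFree Xfree v u

/-- The graph in which a query `(s, g)` is answered: in the roadmap, `s` and `g` are moreover
joined to those of their near neighbors in `V` which they see along a collision-free line. -/
def queryGraph {d : ℕ} (Xfree : Set (Conf d)) (near : Conf d → Finset (Conf d) → Finset (Conf d))
    (V : Finset (Conf d)) (s g : Conf d) : SimpleGraph (Conf d) :=
  roadmap Xfree near V ⊔
    SimpleGraph.fromRel fun x u => (x = s ∨ x = g) ∧ u ∈ near x V ∧ CollisionFree Xfree x u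

/-- Euclidean length of a walk. -/
noncomputable def walkLength {d : ℕ} {G : SimpleGraph (Conf d)} :
    {u v : Conf d} → G.Walk u v → ℝ
  | _, _, .nil => 0
  | _, _, .cons (u := u) (v := v) _ p => dist u v + walkLength p

/-- The continuous piecewise linear path in `ℝᵈ` that follows a walk. -/
noncomputable def walkPath {d : ℕ} {G : SimpleGraph (Conf d)} :
    {u v : Conf d} → G.Walk u v → Path u v
  | u, _, .nil => Path.refl u
  | _, _, .cons (u := u) (v := v) _ p => (Path.segment u v).trans (walkPath p)

/-- `w` is a shortest path, a possible output of the shortest-path search. -/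
def IsShortest {d : ℕ} {G : SimpleGraph (Conf d)} {s g : Conf d} (w : G.Walk s g) : Prop :=
  ∀ w' : G.Walk s g, walkLength w ≤ walkLength w'

/-- The PRM with vertex set `V` answers the query `(s, g)` by a feasible path: the shortest-path
search has something to return, and whatever it returns is a path inside the free space. -/
def ReturnsFeasiblePath {d : ℕ} (Xfree : Set (Conf d))
    (near : Conf d → Finset (Conf d) → Finset (Conf d)) (V : Finset (Conf d))
    (s g : Conf d) : Prop :=
  (∃ w : (queryGraph Xfree near V s g).Walk s g, IsShortest w) ∧
    ∀ w : (queryGraph Xfree near V s g).Walk s g, IsShortest w → ∀ t, walkPath w t ∈ Xfree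

open Classical in
/-- The finite set of sampled points. -/
noncomputable def sampleSet {d n : ℕ} (x : Fin n → Conf d) : Finset (Conf d) :=
  Finset.univ.image x

end KnnPrm

/-! Two properties of the samples suffice, and neither mentions a query or a tie-breaking rule, so
one event serves all queries at once. (a) Every ball of radius `2α` inside the free space contains a
sample. (b) Every sample has fewer than `K` other samples within distance `4α`. Two samples in a
common free ball of radius `2α` are then joined by an edge, and following the samples near a
`2α`-clear path connects the query points (`returnsFeasiblePath`).

For (a), a maximal `α`-separated set of centers of free `2α`-balls has at most `2^d / ℙ(B_α)` points
by volume (`exists_separated_cover`). A union bound over the `α`-balls around them costs at most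
`γ/2` (`mul_exp_neg_le`). For (b), conditionally on one sample, the number of others within `4α` is
a sum of independent indicators with mean at most `K - √(2K log(2n/γ))`. A Chernoff bound
(`measure_le_card_filter_le`) gives failure probability at most `γ/(2n)` per sample, hence `γ/2` in
all. -/

namespace KnnPrm

/-! ### Shortest walks and the paths they trace -/

section Walks

variable {d : ℕ} {G : SimpleGraph (Conf d)}

theorem walkLength_cons {u v w : Conf d} (h : G.Adj u v) (p : G.Walk v w) :
    walkLength (.cons h p) = dist u v + walkLength p := rfl

theorem mul_length_le_walkLength {ε : ℝ} (hε : ∀ u v, G.Adj u v → ε ≤ dist u v) {u v : Conf d}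
    (p : G.Walk u v) : ε * p.length ≤ walkLength p := by
  induction p with
  | nil => simp [walkLength]
  | cons h p ih =>
    rw [walkLength_cons, SimpleGraph.Walk.length_cons]
    push_cast
    linarith [hε _ _ h]

theorem finite_walkLengths {F : Finset (Conf d)} (hF : ∀ u v, G.Adj u v → v ∈ F) (m : ℕ)
    (u v : Conf d) : {x | ∃ p : G.Walk u v, p.length ≤ m ∧ walkLength p = x}.Finite := by
  induction m generalizing u with
  | zero =>
    refine (Set.finite_singleton (0 : ℝ)).subset ?_
    rintro x ⟨p, hp, rfl⟩
    cases p with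
    | nil => rfl
    | cons h p => simp at hp
  | succ m ih =>
    refine ((Set.finite_singleton (0 : ℝ)).union
      (F.finite_toSet.biUnion fun w _ => (ih w).image fun x => dist u w + x)).subset ?_
    rintro x ⟨p, hp, rfl⟩
    cases p with
    | nil => exact Or.inl rfl
    | cons h p =>
      refine Or.inr (Set.mem_biUnion (hF _ _ h) ⟨walkLength p, ⟨p, ?_, rfl⟩, rfl⟩)
      simpa using hp

/-- There are infinitely many walks, but edges between finitely many vertices have lengths bounded
below by some `ε > 0`. A walk no longer than a given one thus has boundedly many edges, which leaves
finitely many candidate lengths. -/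
theorem exists_isShortest {F : Finset (Conf d)} (hF : ∀ u v, G.Adj u v → v ∈ F) {s g : Conf d}
    (h : G.Reachable s g) : ∃ p : G.Walk s g, IsShortest p := by
  classical
  obtain ⟨p₀⟩ := h
  obtain ⟨ε, hε0, hε⟩ : ∃ ε > 0, ∀ u v, G.Adj u v → ε ≤ dist u v := by
    obtain ⟨ε, hε0, hε⟩ : ∃ ε > 0, ∀ q ∈ F.offDiag, ε ≤ dist q.1 q.2 := by
      rcases F.offDiag.eq_empty_or_nonempty with h | h
      · exact ⟨1, one_pos, by simp [h]⟩
      · obtain ⟨q, hq, hmin⟩ := F.offDiag.exists_min_image (fun q => dist q.1 q.2) h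
        exact ⟨_, dist_pos.2 (Finset.mem_offDiag.1 hq).2.2, hmin⟩
    exact ⟨ε, hε0, fun u v huv => hε (u, v)
      (Finset.mem_offDiag.2 ⟨hF _ _ huv.symm, hF _ _ huv, huv.ne⟩)⟩
  obtain ⟨m, hm⟩ := exists_nat_ge (walkLength p₀ / ε)
  have short : ∀ p : G.Walk s g, walkLength p ≤ walkLength p₀ → p.length ≤ m := by
    intro p hp
    have h1 := mul_length_le_walkLength hε p
    have h2 : (p.length : ℝ) ≤ walkLength p₀ / ε := by
      rw [le_div_iff₀ hε0]; linarith
    exact_mod_cast h2.trans hm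
  obtain ⟨x, ⟨p, hp, rfl⟩, hmin⟩ := Set.exists_min_image _ id (finite_walkLengths hF m s g)
    ⟨_, p₀, short p₀ le_rfl, rfl⟩
  refine ⟨p, fun q => ?_⟩
  rcases le_total (walkLength q) (walkLength p₀) with hq | hq
  · exact hmin _ ⟨q, short q hq, rfl⟩
  · exact (hmin _ ⟨p₀, short p₀ le_rfl, rfl⟩).trans hq

theorem walkPath_mem {X : Set (Conf d)} (hG : ∀ u v, G.Adj u v → CollisionFree X u v)
    {s g : Conf d} (p : G.Walk s g) (hs : s ∈ X) (t : unitInterval) : walkPath p t ∈ X := by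
  suffices Set.range (walkPath p) ⊆ X from this ⟨t, rfl⟩
  clear t
  induction p with
  | nil => rintro _ ⟨t, rfl⟩; simpa [walkPath] using hs
  | cons h p ih =>
    have hs' := hG _ _ h
    rw [walkPath, Path.trans_range, Path.range_segment]
    exact Set.union_subset hs' (ih (hs' (right_mem_segment ℝ _ _)))

end Walks

/-! ### Deterministic correctness of the roadmap -/

section Roadmap

variable {d : ℕ} {X : Set (Conf d)} {near : Conf d → Finset (Conf d) → Finset (Conf d)}
  {V : Finset (Conf d)} {K : ℕ}

theorem CollisionFree.symm {u v : Conf d} (h : CollisionFree X u v) : CollisionFree X v u := by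
  rwa [CollisionFree, segment_symm]

theorem queryGraph_adj_collisionFree {s g u v : Conf d} (h : (queryGraph X near V s g).Adj u v) :
    CollisionFree X u v := by
  simp only [queryGraph, roadmap, SimpleGraph.sup_adj, SimpleGraph.fromRel_adj] at h
  rcases h with ⟨-, h | h⟩ | ⟨-, h | h⟩
  exacts [h.2.2, h.2.2.symm, h.2.2, h.2.2.symm]

theorem queryGraph_adj_mem (hnear : IsKNearSearch K near) {s g u v : Conf d}
    (h : (queryGraph X near V s g).Adj u v) : v ∈ insert s (insert g V) := by
  simp only [queryGraph, roadmap, SimpleGraph.sup_adj, SimpleGraph.fromRel_adj] at h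
  simp only [Finset.mem_insert]
  rcases h with ⟨-, ⟨-, h, -⟩ | ⟨h, -⟩⟩ | ⟨-, ⟨-, h, -⟩ | ⟨h, -⟩⟩
  · exact Or.inr (Or.inr (Finset.mem_of_mem_erase ((hnear _ _).1 h)))
  · exact Or.inr (Or.inr h)
  · exact Or.inr (Or.inr ((hnear _ _).1 h))
  · rcases h with h | h <;> simp [h]

/-- Were `u` omitted, `U` would consist of `K` points at least as close as `u`; together with `u`
they would be `K + 1` points within distance `r`. -/
theorem IsKNearest.mem_of_card_le {v u : Conf d} {S U : Finset (Conf d)} (h : IsKNearest K v S U)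
    {r : ℝ} (hcard : (S.filter fun w => dist v w < r).card ≤ K) (hu : u ∈ S) (hr : dist v u < r) :
    u ∈ U := by
  obtain ⟨hUS, hc, hle⟩ := h
  by_contra hn
  have hlt : U.card < S.card := Finset.card_lt_card ((Finset.ssubset_iff_of_subset hUS).2 ⟨u, hu, hn⟩)
  have hUK : U.card = K := by omega
  have hss : U ⊂ S.filter fun w => dist v w < r :=
    (Finset.ssubset_iff_of_subset fun w hw =>
      Finset.mem_filter.2 ⟨hUS hw, (hle w hw u hu hn).trans_lt hr⟩).2
      ⟨u, Finset.mem_filter.2 ⟨hu, hr⟩, hn⟩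
  have := Finset.card_lt_card hss
  omega

theorem IsKNearest.exists_nearest (hK : 0 < K) {v : Conf d} {S U : Finset (Conf d)}
    (h : IsKNearest K v S U) (hS : S.Nonempty) : ∃ u ∈ U, ∀ w ∈ S, dist v u ≤ dist v w := by
  obtain ⟨hUS, hc, hle⟩ := h
  have hU : U.Nonempty := by
    rw [← Finset.card_pos] at hS ⊢; omega
  obtain ⟨u, hu, hmin⟩ := U.exists_min_image (dist v) hU
  exact ⟨u, hu, fun w hw => if hwU : w ∈ U then hmin w hwU else hle u hu w hw hwU⟩

theorem collisionFree_of_mem_ball {c u v : Conf d} {r : ℝ} (h : Metric.ball c r ⊆ X)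
    (hu : u ∈ Metric.ball c r) (hv : v ∈ Metric.ball c r) : CollisionFree X u v :=
  ((convex_ball c r).segment_subset hu hv).trans h

/-- A query point that sees a ball around it containing a sample is connected to a sample in that
ball. -/
theorem exists_reachable_near (hK : 0 < K) (hnear : IsKNearSearch K near) {s g x : Conf d}
    (hx : x = s ∨ x = g) {r : ℝ} (hr : 0 < r) (hX : Metric.ball x r ⊆ X)
    (hV : ∃ v ∈ V, v ∈ Metric.ball x r) :
    ∃ v ∈ V, v ∈ Metric.ball x r ∧ (queryGraph X near V s g).Reachable x v := by
  obtain ⟨v, hv, hvx⟩ := hV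
  obtain ⟨u, hu, hmin⟩ := (hnear x V).exists_nearest hK ⟨v, hv⟩
  have hux : u ∈ Metric.ball x r := by
    rw [Metric.mem_ball'] at hvx ⊢; exact (hmin v hv).trans_lt hvx
  refine ⟨u, (hnear x V).1 hu, hux, ?_⟩
  by_cases hxu : x = u
  · rw [← hxu]
  · refine SimpleGraph.Adj.reachable (Or.inr ?_)
    exact (SimpleGraph.fromRel_adj _ _ _).2
      ⟨hxu, Or.inl ⟨hx, hu, collisionFree_of_mem_ball hX (Metric.mem_ball_self hr) hux⟩⟩

/-- Samples in a common free ball of radius `r` are less than `2 * r` apart, so `hcard` makes each a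
chosen neighbor of the other; convexity of the ball makes the edge free. -/
theorem returnsFeasiblePath (hK : 0 < K) (hnear : IsKNearSearch K near)
    {r : ℝ} (hr : 0 < r)
    (hnet : ∀ c, Metric.ball c r ⊆ X → ∃ v ∈ V, v ∈ Metric.ball c r)
    (hcard : ∀ v ∈ V, ((V.erase v).filter fun w => dist v w < 2 * r).card ≤ K)
    {s g : Conf d} (σ : Path s g) (hσ : IsClear X r σ) : ReturnsFeasiblePath X near V s g := by
  have hsX : Metric.ball s r ⊆ X := by simpa using hσ 0
  have hgX : Metric.ball g r ⊆ X := by simpa using hσ 1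
  refine ⟨exists_isShortest (fun u v h => queryGraph_adj_mem hnear h) ?_, fun w _ t =>
    walkPath_mem (fun u v h => queryGraph_adj_collisionFree h) w (hsX (Metric.mem_ball_self hr)) t⟩
  set G := queryGraph X near V s g
  have hadj : ∀ c, Metric.ball c r ⊆ X → ∀ u ∈ V, ∀ v ∈ V, u ∈ Metric.ball c r →
      v ∈ Metric.ball c r → G.Reachable u v := by
    intro c hc u hu v hv huc hvc
    by_cases huv : u = v
    · rw [huv]
    · refine SimpleGraph.Adj.reachable (Or.inl ?_)
      refine (SimpleGraph.fromRel_adj _ _ _).2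
        ⟨huv, Or.inl ⟨hu, ?_, collisionFree_of_mem_ball hc huc hvc⟩⟩
      refine (hnear u _).mem_of_card_le (r := 2 * r) ?_ ?_ ?_
      · convert hcard u hu
      · simp [hv, Ne.symm huv]
      · have := dist_triangle_right u v c
        rw [Metric.mem_ball] at huc hvc
        linarith
  obtain ⟨u₀, hu₀, hu₀s, hsu₀⟩ := exists_reachable_near (X := X) hK hnear (g := g) (Or.inl rfl) hr hsX
    (hnet _ hsX)
  obtain ⟨u₁, hu₁, hu₁g, hgu₁⟩ := exists_reachable_near (X := X) hK hnear (s := s) (Or.inr rfl) hr hgX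
    (hnet _ hgX)
  have hopen : ∀ v, IsOpen {t | v ∈ Metric.ball (σ t) r} := fun v => by
    simp only [Metric.mem_ball]
    exact isOpen_lt (by fun_prop) continuous_const
  -- Connectedness of the time interval replaces a subdivision of the path: a sample in the ball at
  -- time `t` stays in the ball for nearby times, which makes both `T` and its complement open.
  let T : Set unitInterval := {t | ∃ v ∈ V, v ∈ Metric.ball (σ t) r ∧ G.Reachable s v}
  have hT : IsClopen T := by
    constructor
    · rw [← isOpen_compl_iff, isOpen_iff_mem_nhds]
      intro t ht
      obtain ⟨v, hv, hvt⟩ := hnet _ (hσ t)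
      filter_upwards [(hopen v).mem_nhds hvt] with t' ht'
      rintro ⟨v', hv', hvt', hsv'⟩
      exact ht ⟨v, hv, hvt, hsv'.trans (hadj _ (hσ t') _ hv' _ hv hvt' ht')⟩
    · rw [isOpen_iff_mem_nhds]
      rintro t ⟨v, hv, hvt, hsv⟩
      filter_upwards [(hopen v).mem_nhds hvt] with t' ht'
      exact ⟨v, hv, ht', hsv⟩
  have hTu : T = Set.univ := hT.eq_univ ⟨0, u₀, hu₀, by simpa using hu₀s, hsu₀⟩
  obtain ⟨v, hv, hvg, hsv⟩ : (1 : unitInterval) ∈ T := hTu ▸ Set.mem_univ _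
  rw [σ.target] at hvg
  exact (hsv.trans (hadj g hgX _ hv _ hu₁ hvg hu₁g)).trans hgu₁.symm

end Roadmap

/-! ### A Chernoff bound for neighbor counts -/

section Concentration

open scoped ENNReal

variable {ι Ω E : Type*} [MeasurableSpace Ω] [MeasurableSpace E] {P : Measure Ω}

/-- If `Y` is independent of the independent family `N`, a product of functions of `Y` and `N j` is
integrated by freezing `Y`. -/
theorem lintegral_prod_le_pow [DecidableEq ι] [IsProbabilityMeasure P] {N : ι → Ω → E}
    (hmeas : ∀ i, Measurable (N i))
    (hind : iIndepFun N P) {f : E → E → ℝ≥0∞} (hf : Measurable fun z : E × E => f z.1 z.2)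
    {M : ℝ≥0∞} (hM : ∀ x j, ∫⁻ ω, f x (N j ω) ∂P ≤ M) (i : ι) (s : Finset ι) (his : i ∉ s) :
    ∫⁻ ω, ∏ j ∈ s, f (N i ω) (N j ω) ∂P ≤ M ^ s.card := by
  have hYmeas : Measurable fun ω (j : s) => N j ω := measurable_pi_lambda _ fun j => hmeas j
  have hY : IndepFun (N i) (fun ω (j : s) => N j ω) P :=
    (hind.indepFun_finset {i} s (Finset.disjoint_singleton_left.2 his) hmeas).comp
      (φ := fun z : ({i} : Finset ι) → E => z ⟨i, Finset.mem_singleton_self i⟩) (ψ := id)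
      (measurable_pi_apply _) measurable_id
  have hprod : Measurable fun z : E × (s → E) => ∏ j : s, f z.1 (z.2 j) :=
    Finset.measurable_fun_prod _ fun j _ =>
      hf.comp (measurable_fst.prodMk ((measurable_pi_apply j).comp measurable_snd))
  calc ∫⁻ ω, ∏ j ∈ s, f (N i ω) (N j ω) ∂P
      = ∫⁻ ω, (fun z : E × (s → E) => ∏ j : s, f z.1 (z.2 j)) (N i ω, fun j => N j ω) ∂P := by
        refine lintegral_congr fun ω => ?_
        exact (Finset.prod_coe_sort s fun j => f (N i ω) (N j ω)).symm
    _ = ∫⁻ x, ∫⁻ y, ∏ j : s, f x (y j) ∂(P.map fun ω (j : s) => N j ω) ∂(P.map (N i)) := by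
        rw [← lintegral_map hprod ((hmeas i).prodMk hYmeas),
          hY.map_prod_eq_prod_map_map (hmeas i).aemeasurable hYmeas.aemeasurable,
          lintegral_prod _ hprod.aemeasurable]
    _ ≤ ∫⁻ x, M ^ s.card ∂(P.map (N i)) := by
        refine lintegral_mono fun x => ?_
        have hfx : Measurable (f x) := hf.comp measurable_prodMk_left
        rw [lintegral_map (f := fun y : s → E => ∏ j : s, f x (y j))
          (hprod.comp measurable_prodMk_left) hYmeas]
        rw [lintegral_congr fun ω => Finset.prod_coe_sort s fun j => f x (N j ω)]
        rw [lintegral_prod_eq_prod_lintegral_of_indepFun s (fun j ω => f x (N j ω))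
          (hind.comp (fun _ => f x) fun _ => hfx) fun j => hfx.comp (hmeas j)]
        exact Finset.prod_le_pow_card _ _ _ fun j _ => hM x j
    _ = M ^ s.card := by
        have := Measure.isProbabilityMeasure_map (μ := P) (hmeas i).aemeasurable
        simp

open Classical in
theorem measurable_card_filter [Countable ι] {N : ι → Ω → E} (hmeas : ∀ i, Measurable (N i))
    {S : Set (E × E)} (hS : MeasurableSet S) (i : ι) (s : Finset ι) :
    Measurable fun ω => (s.filter fun j => (N i ω, N j ω) ∈ S).card := by
  simp only [Finset.card_filter]
  exact Finset.measurable_fun_sum _ fun j _ =>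
    Measurable.ite (((hmeas i).prodMk (hmeas j)) hS) measurable_const measurable_const

open Classical in
-- Markov's inequality for `(1 + b) ^ count`, which is a product of factors `1 + b · 1_S`, each of
-- mean at most `1 + b * q` once `N i` is frozen.
theorem measure_le_card_filter_mul_le [IsProbabilityMeasure P] {N : ι → Ω → E}
    (hmeas : ∀ i, Measurable (N i)) (hind : iIndepFun N P) {S : Set (E × E)} (hS : MeasurableSet S)
    {q : ℝ≥0∞} (hq : ∀ x j, P {ω | (x, N j ω) ∈ S} ≤ q) (b : ℝ≥0∞) (k : ℕ) (i : ι) (s : Finset ι)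
    (his : i ∉ s) :
    (1 + b) ^ k * P {ω | k ≤ (s.filter fun j => (N i ω, N j ω) ∈ S).card} ≤
      (1 + b * q) ^ s.card := by
  let f : E → E → ℝ≥0∞ := fun x y => 1 + S.indicator (fun _ => b) (x, y)
  have hf : Measurable fun z : E × E => f z.1 z.2 :=
    (measurable_const.indicator hS).const_add 1
  have hprod : ∀ ω, ∏ j ∈ s, f (N i ω) (N j ω) =
      (1 + b) ^ (s.filter fun j => (N i ω, N j ω) ∈ S).card := by
    intro ω
    rw [← Finset.prod_const, Finset.prod_filter]
    refine Finset.prod_congr rfl fun j _ => ?_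
    by_cases h : (N i ω, N j ω) ∈ S <;> simp [f, h]
  have hM : ∀ x j, ∫⁻ ω, f x (N j ω) ∂P ≤ 1 + b * q := by
    intro x j
    have hm : MeasurableSet {ω | (x, N j ω) ∈ S} := (measurable_const.prodMk (hmeas j)) hS
    have : ∀ ω, f x (N j ω) = 1 + {ω | (x, N j ω) ∈ S}.indicator (fun _ => b) ω := fun ω => rfl
    simp only [this]
    rw [lintegral_add_left measurable_const, lintegral_indicator_const hm]
    simp only [lintegral_const, measure_univ, mul_one]
    gcongr
    exact hq x j
  calc _ ≤ (1 + b) ^ k * P {ω | (1 + b) ^ k ≤ ∏ j ∈ s, f (N i ω) (N j ω)} := by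
        gcongr with ω
        intro h
        rw [hprod]
        exact pow_le_pow_right₀ le_self_add h
    _ ≤ ∫⁻ ω, ∏ j ∈ s, f (N i ω) (N j ω) ∂P :=
        mul_meas_ge_le_lintegral (Finset.measurable_fun_prod _ fun j _ =>
          hf.comp ((hmeas i).prodMk (hmeas j))) _
    _ ≤ _ := lintegral_prod_le_pow hmeas hind hf hM i s his

/-- The first two terms of the logarithm series, whose terms are all nonnegative. -/
theorem add_sq_div_two_le_neg_log {y : ℝ} (h0 : 0 ≤ y) (h1 : y < 1) :
    y + y ^ 2 / 2 ≤ -Real.log (1 - y) := by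
  have h := sum_le_hasSum (Finset.range 2) (fun n _ => by positivity)
    (Real.hasSum_pow_div_log_of_abs_lt_one (x := y) (by rwa [abs_of_nonneg h0]))
  norm_num [Finset.sum_range_succ] at h
  linarith

/-- The Chernoff exponent for exceeding `K` with mean `μ`. -/
theorem pow_mul_exp_sub_le {K : ℕ} {μ L : ℝ} (hL : 0 ≤ L) (hμ : 0 < μ)
    (hμK : μ = K - √(2 * K * L)) : (μ / K) ^ K * Real.exp (K - μ) ≤ Real.exp (-L) := by
  have hsqrt : 0 ≤ √(2 * K * L) := Real.sqrt_nonneg _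
  have hK : (0 : ℝ) < K := by linarith
  have hsq : (K - μ) ^ 2 = 2 * K * L := by
    rw [hμK, sub_sub_cancel, Real.sq_sqrt (by positivity)]
  -- With this `y`, the quadratic term `y ^ 2 / 2` is exactly `L / K`, and the linear term cancels
  -- the factor `exp (K - μ)`.
  have hlog := add_sq_div_two_le_neg_log (y := (K - μ) / K)
    (div_nonneg (by linarith) hK.le) (by rw [div_lt_one hK]; linarith)
  have h1 : 1 - (K - μ) / K = μ / K := by field_simp; ring
  rw [h1] at hlog
  have h2 : ((K - μ) / K) ^ 2 / 2 = L / K := by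
    rw [div_pow, hsq]; field_simp
  rw [h2] at hlog
  rw [← Real.exp_log (show 0 < (μ / K) ^ K by positivity), ← Real.exp_add, Real.exp_le_exp,
    Real.log_pow]
  have h3 := mul_le_mul_of_nonneg_left hlog hK.le
  have h4 : (K : ℝ) * ((K - μ) / K + L / K) = K - μ + L := by field_simp
  linarith

open Classical in
/-- A Chernoff bound for the number of members of an independent family that are related to one
further member. -/
theorem measure_le_card_filter_le [IsProbabilityMeasure P] {N : ι → Ω → E}
    (hmeas : ∀ i, Measurable (N i)) (hind : iIndepFun N P) {S : Set (E × E)} (hS : MeasurableSet S)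
    {q : ℝ} (hq0 : 0 ≤ q) (hq : ∀ x j, P {ω | (x, N j ω) ∈ S} ≤ ENNReal.ofReal q) {K : ℕ}
    {μ L : ℝ} (hL : 0 ≤ L) (hμ : 0 < μ) (hμK : μ = K - √(2 * K * L)) (i : ι) (s : Finset ι)
    (his : i ∉ s) (hsq : s.card * q ≤ μ) :
    P {ω | K ≤ (s.filter fun j => (N i ω, N j ω) ∈ S).card} ≤ ENNReal.ofReal (Real.exp (-L)) := by
  have hμ' : μ ≤ K := by linarith [Real.sqrt_nonneg (2 * K * L)]
  have hK : (0 : ℝ) < K := hμ.trans_le hμ'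
  -- This is the optimal Chernoff parameter for mean `μ` and threshold `K`: `1 + b = K / μ`.
  set b : ℝ := (K - μ) / μ with hb
  have hb0 : 0 ≤ b := div_nonneg (by linarith) hμ.le
  have hb1 : 1 + b = K / μ := by rw [hb]; field_simp; ring
  have key := measure_le_card_filter_mul_le hmeas hind hS hq (ENNReal.ofReal b) K i s his
  rw [← ENNReal.ofReal_one, ← ENNReal.ofReal_mul hb0, ← ENNReal.ofReal_add zero_le_one hb0,
    ← ENNReal.ofReal_add zero_le_one (by positivity), ← ENNReal.ofReal_pow (by positivity),
    ← ENNReal.ofReal_pow (by positivity), hb1, ← ofReal_measureReal,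
    ← ENNReal.ofReal_mul (by positivity),
    ENNReal.ofReal_le_ofReal_iff (by positivity)] at key
  rw [← ofReal_measureReal]
  refine ENNReal.ofReal_le_ofReal ?_
  refine le_trans ?_ (pow_mul_exp_sub_le hL hμ hμK)
  have h1 : (1 + b * q) ^ s.card ≤ Real.exp (K - μ) := by
    calc (1 + b * q) ^ s.card ≤ Real.exp (b * q) ^ s.card := by
          gcongr; linarith [Real.add_one_le_exp (b * q)]
      _ = Real.exp (b * (s.card * q)) := by rw [← Real.exp_nat_mul]; ring_nf
      _ ≤ Real.exp (b * μ) := by gcongr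
      _ = Real.exp (K - μ) := by rw [hb]; field_simp
  have h2 : (μ / K) ^ K * (K / μ) ^ K = 1 := by
    rw [← mul_pow]; field_simp; simp
  calc _ = (μ / K) ^ K * ((K / μ) ^ K *
        P.real {ω | K ≤ (s.filter fun j => (N i ω, N j ω) ∈ S).card}) := by
        rw [← mul_assoc, h2, one_mul]
    _ ≤ _ := by gcongr; exact key.trans h1

end Concentration

/-! ### Ball volumes, packing and the sample size -/

section BallProb

variable {d : ℕ} {X : Set (Conf d)}

theorem ballProb_nonneg (r : ℝ) : 0 ≤ ballProb X r := by unfold ballProb; positivity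

theorem ballProb_mul {a r : ℝ} (ha : 0 ≤ a) (hr : 0 ≤ r) :
    ballProb X (a * r) = a ^ d * ballProb X r := by
  simp only [ballProb, ← measureReal_def]
  rw [Measure.addHaar_real_closedBall _ _ hr, Measure.addHaar_real_closedBall _ _ (mul_nonneg ha hr),
    finrank_euclideanSpace_fin]
  ring

theorem volume_real_ball_eq (hpos : volume X ≠ 0) (hfin : volume X ≠ ⊤) (hd : 0 < d) (c : Conf d)
    (r : ℝ) : volume.real (Metric.ball c r) = ballProb X r * volume.real X := by
  -- In dimension 0 the open and closed balls of radius 0 have different volumes.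
  have : Nonempty (Fin d) := ⟨⟨0, hd⟩⟩
  have hX : volume.real X ≠ 0 := (ENNReal.toReal_pos hpos hfin).ne'
  rw [ballProb, ← measureReal_def, ← measureReal_def, div_mul_cancel₀ _ hX,
    ← Measure.addHaar_real_closedBall_eq_addHaar_real_ball]
  by_cases hr : 0 ≤ r
  · rw [Measure.addHaar_real_closedBall _ _ hr, Measure.addHaar_real_closedBall _ _ hr]
  · push Not at hr
    rw [Metric.closedBall_eq_empty.2 hr, Metric.closedBall_eq_empty.2 hr]

theorem ballProb_pos (hpos : volume X ≠ 0) (hfin : volume X ≠ ⊤) (hd : 0 < d) {r : ℝ}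
    (hr : 0 < r) : 0 < ballProb X r := by
  have hX : 0 < volume.real X := ENNReal.toReal_pos hpos hfin
  have h : 0 < volume.real (Metric.ball (0 : Conf d) r) :=
    ENNReal.toReal_pos (Metric.measure_ball_pos _ _ hr).ne' measure_ball_lt_top.ne
  rw [volume_real_ball_eq hpos hfin hd] at h
  exact pos_of_mul_pos_left h hX.le

/-- Disjoint balls inside the free space: their number is bounded by volume. -/
theorem card_mul_ballProb_le_one (hpos : volume X ≠ 0) (hfin : volume X ≠ ⊤) (hd : 0 < d) {r : ℝ}
    {T : Finset (Conf d)} (hT : ∀ c ∈ T, Metric.ball c r ⊆ X)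
    (hsep : (T : Set (Conf d)).Pairwise fun a b => 2 * r ≤ dist a b) :
    T.card * ballProb X r ≤ 1 := by
  have hX : 0 < volume.real X := ENNReal.toReal_pos hpos hfin
  have hdisj : (T : Set (Conf d)).PairwiseDisjoint fun c => Metric.ball c r := fun a ha b hb hab =>
    Metric.ball_disjoint_ball (by linarith [hsep ha hb hab])
  have h := measureReal_mono (Set.iUnion₂_subset hT) hfin
  rw [measureReal_biUnion_finset hdisj fun _ _ => measurableSet_ball,
    Finset.sum_congr rfl fun c _ => volume_real_ball_eq hpos hfin hd c r, Finset.sum_const,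
    nsmul_eq_mul, ← mul_assoc] at h
  exact le_of_mul_le_mul_right (by rwa [one_mul]) hX

/-- The packing bound allows a `2 * r`-separated subset of `S` of maximal cardinality; a point of
`S` that it fails to cover could be added to it. -/
theorem exists_separated_cover (hpos : volume X ≠ 0) (hfin : volume X ≠ ⊤) (hd : 0 < d) {r : ℝ}
    (hr : 0 < r) {S : Set (Conf d)} (hS : ∀ c ∈ S, Metric.ball c r ⊆ X) :
    ∃ T : Finset (Conf d), ↑T ⊆ S ∧ (∀ c ∈ S, ∃ t ∈ T, dist c t < 2 * r) ∧
      T.card * ballProb X r ≤ 1 := by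
  let A : Set ℕ := {m | ∃ T : Finset (Conf d), ↑T ⊆ S ∧
    ((T : Set (Conf d)).Pairwise fun a b => 2 * r ≤ dist a b) ∧ T.card = m}
  have hp := ballProb_pos hpos hfin hd hr
  have hbdd : BddAbove A := by
    refine ⟨⌊1 / ballProb X r⌋₊, ?_⟩
    rintro _ ⟨T, hTS, hsep, rfl⟩
    exact Nat.le_floor ((le_div_iff₀ hp).2
      (card_mul_ballProb_le_one hpos hfin hd (fun c hc => hS c (hTS hc)) hsep))
  obtain ⟨T, hTS, hsep, hT⟩ := Nat.sSup_mem (s := A) ⟨0, ∅, by simp⟩ hbdd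
  refine ⟨T, hTS, fun c hc => ?_,
    card_mul_ballProb_le_one hpos hfin hd (fun c hc => hS c (hTS hc)) hsep⟩
  by_contra! hcon
  have hcT : c ∉ T := fun h => by simpa using (hcon c h).trans_lt' (by positivity : 0 < 2 * r)
  have hmem : (insert c T).card ∈ A := by
    refine ⟨insert c T, ?_, ?_, rfl⟩
    · rw [Finset.coe_insert]; exact Set.insert_subset hc hTS
    · rw [Finset.coe_insert]
      exact hsep.insert fun b hb _ => ⟨hcon b hb, by rw [dist_comm]; exact hcon b hb⟩
  have := le_csSup hbdd hmem
  rw [Finset.card_insert_of_notMem hcT] at this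
  omega

theorem mul_exp_neg_le {p γ m n : ℝ} (hd : 0 < d) (hp : 0 < p) (hp1 : p ≤ 1) (hγ0 : 0 < γ)
    (hγ1 : γ < 1) (hm : m * p ≤ 2 ^ d) (hn0 : 0 ≤ m)
    (hn1 : 4 / p * Real.logb 2 (4 / γ) ≤ n) (hn2 : 8 * d / p * Real.logb 2 (13 / p) ≤ n) :
    m * Real.exp (-(p * n)) ≤ γ / 2 := by
  have hlog : ∀ x : ℝ, 1 ≤ x → Real.log x ≤ Real.logb 2 x := fun x hx => by
    rw [Real.logb, le_div_iff₀ (Real.log_pos one_lt_two)]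
    nlinarith [Real.log_nonneg hx, Real.log_two_lt_d9]
  have h4 : 1 ≤ 4 / γ := by rw [le_div_iff₀ hγ0]; linarith
  have h13 : 1 ≤ 13 / p := by rw [le_div_iff₀ hp]; linarith
  have hd1 : (1 : ℝ) ≤ d := by exact_mod_cast hd
  have e1 : 4 * Real.log (4 / γ) ≤ p * n := by
    have := mul_le_mul_of_nonneg_left hn1 hp.le
    have e : p * (4 / p * Real.logb 2 (4 / γ)) = 4 * Real.logb 2 (4 / γ) := by field_simp
    linarith [hlog _ h4]
  have e2 : 8 * (d * Real.log (13 / p)) ≤ p * n := by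
    have := mul_le_mul_of_nonneg_left hn2 hp.le
    have e : p * (8 * d / p * Real.logb 2 (13 / p)) = 8 * (d * Real.logb 2 (13 / p)) := by
      field_simp
    have := mul_le_mul_of_nonneg_left (hlog _ h13) (by positivity : (0 : ℝ) ≤ d)
    linarith
  -- The average of `e1` and `e2` bounds `p * n` below by the sum of both terms, with room to spare.
  have e3 : -(p * n) ≤ -Real.log (4 / γ) + -(d * Real.log (13 / p)) := by
    linarith [Real.log_nonneg h4, mul_nonneg (by positivity : (0 : ℝ) ≤ d) (Real.log_nonneg h13)]
  have e4 : Real.exp (-(p * n)) ≤ γ / 4 * (p / 13) ^ d := by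
    refine (Real.exp_le_exp.2 e3).trans_eq ?_
    rw [Real.exp_add, Real.exp_neg, Real.exp_log (by positivity), ← Real.log_pow, Real.exp_neg,
      Real.exp_log (by positivity), inv_div, ← inv_pow, inv_div]
  have e5 : (p / 13) ^ d ≤ p * (1 / 2) ^ d := by
    calc (p / 13) ^ d = p ^ d * (1 / 13) ^ d := by rw [← mul_pow]; ring
      _ ≤ p * (1 / 2) ^ d := by
        gcongr ?_ * ?_ ^ d
        · exact pow_le_of_le_one hp.le hp1 hd.ne'
        · norm_num
  calc m * Real.exp (-(p * n)) ≤ m * (γ / 4 * (p * (1 / 2) ^ d)) := by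
        gcongr; exact e4.trans (by gcongr)
    _ = γ / 4 * (m * p * (1 / 2) ^ d) := by ring
    _ ≤ γ / 4 * (2 ^ d * (1 / 2) ^ d) := by gcongr
    _ = γ / 4 := by rw [← mul_pow]; norm_num
    _ ≤ γ / 2 := by linarith

end BallProb

/-! ### Uniform samples and balls -/

section Sampling

variable {d : ℕ} {X : Set (Conf d)} {Ω : Type*} [MeasurableSpace Ω] {P : Measure Ω}

/-- The ball may stick out of the free space; intersecting with `X` only loses volume. -/
theorem measure_mem_ball_le (hpos : volume X ≠ 0) (hfin : volume X ≠ ⊤) (hd : 0 < d)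
    {Y : Ω → Conf d} (hY : pdf.IsUniform Y X P volume) (c : Conf d) (r : ℝ) :
    P (Y ⁻¹' Metric.ball c r) ≤ ENNReal.ofReal (ballProb X r) := by
  rw [hY.measure_preimage hpos hfin measurableSet_ball]
  refine ENNReal.div_le_of_le_mul ?_
  rw [← ofReal_measureReal (μ := volume) (s := X) hfin, ← ENNReal.ofReal_mul (ballProb_nonneg _),
    ← volume_real_ball_eq hpos hfin hd c, ofReal_measureReal measure_ball_lt_top.ne]
  exact measure_mono Set.inter_subset_right

theorem measure_mem_ball_eq (hpos : volume X ≠ 0) (hfin : volume X ≠ ⊤) (hd : 0 < d)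
    {Y : Ω → Conf d} (hY : pdf.IsUniform Y X P volume) {c : Conf d} {r : ℝ}
    (hc : Metric.ball c r ⊆ X) : P.real (Y ⁻¹' Metric.ball c r) = ballProb X r := by
  have hX : 0 < volume.real X := ENNReal.toReal_pos hpos hfin
  rw [measureReal_def, hY.measure_preimage hpos hfin measurableSet_ball,
    Set.inter_eq_self_of_subset_right hc, ENNReal.toReal_div, ← measureReal_def, ← measureReal_def,
    volume_real_ball_eq hpos hfin hd, mul_div_cancel_right₀ _ hX.ne']

theorem measure_forall_notMem_ball_le [IsProbabilityMeasure P] (hpos : volume X ≠ 0)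
    (hfin : volume X ≠ ⊤) (hd : 0 < d) {n : ℕ} {N : Fin n → Ω → Conf d}
    (hmeas : ∀ i, Measurable (N i)) (hind : iIndepFun N P)
    (hunif : ∀ i, pdf.IsUniform (N i) X P volume) {c : Conf d} {r : ℝ}
    (hc : Metric.ball c r ⊆ X) :
    P {ω | ∀ i, N i ω ∉ Metric.ball c r} ≤ ENNReal.ofReal (Real.exp (-(ballProb X r * n))) := by
  have h : {ω | ∀ i, N i ω ∉ Metric.ball c r} = ⋂ i, (N i ⁻¹' Metric.ball c r)ᶜ := by
    ext; simp
  rw [h, hind.meas_iInter (s := fun i => (N i ⁻¹' Metric.ball c r)ᶜ)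
    fun i => ⟨(Metric.ball c r)ᶜ, measurableSet_ball.compl, rfl⟩]
  have h1 : ∀ i, P (N i ⁻¹' Metric.ball c r)ᶜ ≤ ENNReal.ofReal (Real.exp (-ballProb X r)) := by
    intro i
    rw [← ofReal_measureReal, probReal_compl_eq_one_sub (hmeas i measurableSet_ball),
      measure_mem_ball_eq hpos hfin hd (hunif i) hc]
    exact ENNReal.ofReal_le_ofReal (Real.one_sub_le_exp_neg _)
  calc _ ≤ ∏ _i : Fin n, ENNReal.ofReal (Real.exp (-ballProb X r)) :=
        Finset.prod_le_prod' fun i _ => h1 i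
    _ = _ := by
        rw [Finset.prod_const, Finset.card_univ, Fintype.card_fin,
          ← ENNReal.ofReal_pow (Real.exp_nonneg _), ← Real.exp_nat_mul]
        ring_nf

/-- Coinciding samples only shrink the set, so counting indices overestimates. -/
theorem card_filter_erase_sampleSet_le {n : ℕ} (x : Fin n → Conf d) (i : Fin n) (r : ℝ) :
    (((sampleSet x).erase (x i)).filter fun w => dist (x i) w < r).card ≤
      ((Finset.univ.erase i).filter fun j => dist (x i) (x j) < r).card := by
  refine (Finset.card_le_card ?_).trans (Finset.card_image_le (f := x))
  intro w hw
  simp only [Finset.mem_filter, Finset.mem_erase, sampleSet, Finset.mem_image, Finset.mem_univ,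
    true_and] at hw
  obtain ⟨⟨hne, j, rfl⟩, hr⟩ := hw
  refine Finset.mem_image.2 ⟨j, ?_, rfl⟩
  simp only [Finset.mem_filter, Finset.mem_erase, Finset.mem_univ, and_true]
  exact ⟨fun h => hne (by rw [h]), hr⟩

end Sampling

end KnnPrm

/-! ### The union bound over missed balls and crowded samples -/

theorem theorem2 {d : ℕ} (hd : 0 < d)
    (Xfree : Set (KnnPrm.Conf d)) (hXmeas : MeasurableSet Xfree)
    (hXpos : volume Xfree ≠ 0) (hXfin : volume Xfree ≠ ⊤)
    {Ω : Type*} [MeasurableSpace Ω] (P : Measure Ω) [IsProbabilityMeasure P]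
    (n K : ℕ) (hn : 2 ≤ n)
    (N : Fin n → Ω → KnnPrm.Conf d) (hNmeas : ∀ i, Measurable (N i))
    (hNindep : iIndepFun N P) (hNunif : ∀ i, pdf.IsUniform (N i) Xfree P volume)
    (α γ : ℝ) (hα : 0 < α) (hγ0 : 0 < γ) (hγ1 : γ < 1)
    (hsample : (n : ℝ) ≥
      max (4 / KnnPrm.ballProb Xfree α * Real.logb 2 (4 / γ))
        (8 * d / KnnPrm.ballProb Xfree α * Real.logb 2 (13 / KnnPrm.ballProb Xfree α)))
    (hroot : 0 ≤ (K : ℝ) - √(2 * K * Real.log (2 * n / γ)))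
    (hradius : α ≤ 1 / 4 *
      (((K : ℝ) - √(2 * K * Real.log (2 * n / γ))) /
        (((n : ℝ) - 1) * KnnPrm.ballProb Xfree 1)) ^ (1 / (d : ℝ))) :
    ∃ A : Set Ω, MeasurableSet A ∧ ENNReal.ofReal (1 - γ) ≤ P A ∧
      ∀ ω ∈ A, ∀ near : KnnPrm.Conf d → Finset (KnnPrm.Conf d) → Finset (KnnPrm.Conf d),
        KnnPrm.IsKNearSearch K near →
        ∀ s ∈ Xfree, ∀ g ∈ Xfree,
          (∃ σ : Path s g, KnnPrm.IsClear Xfree (2 * α) σ) →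
          KnnPrm.ReturnsFeasiblePath Xfree near (KnnPrm.sampleSet fun i => N i ω) s g := by
  classical
  set L : ℝ := Real.log (2 * n / γ) with hLdef
  set μ : ℝ := K - √(2 * K * L) with hμdef
  have hn0 : (0 : ℝ) < n - 1 := by
    have : (2 : ℝ) ≤ n := by exact_mod_cast hn
    linarith
  have hn2 : (2 : ℝ) ≤ n := by exact_mod_cast hn
  have hd0 : (d : ℝ) ≠ 0 := by exact_mod_cast hd.ne'
  have hL : 0 ≤ L := Real.log_nonneg (by rw [le_div_iff₀ hγ0]; linarith)
  have hp1 := KnnPrm.ballProb_pos hXpos hXfin hd one_pos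
  -- If `μ = 0`, the radius condition would force `α ≤ 0`; positivity of `μ` also rules out `K = 0`.
  have hμ : 0 < μ := by
    refine lt_of_le_of_ne hroot fun h => ?_
    rw [← h, zero_div, Real.zero_rpow (one_div_ne_zero hd0), mul_zero] at hradius
    linarith
  have hK : 0 < K := by
    have : (0 : ℝ) < K := by linarith [Real.sqrt_nonneg (2 * K * L)]
    exact_mod_cast this
  have hq : (n - 1) * KnnPrm.ballProb Xfree (2 * (2 * α)) ≤ μ := by
    have h1 : 4 * α ≤ (μ / ((n - 1) * KnnPrm.ballProb Xfree 1)) ^ (1 / (d : ℝ)) := by linarith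
    have h2 := pow_le_pow_left₀ (by positivity) h1 d
    rw [one_div, Real.rpow_inv_natCast_pow (by positivity) hd.ne',
      le_div_iff₀ (by positivity)] at h2
    have h3 := KnnPrm.ballProb_mul (X := Xfree) (by positivity : 0 ≤ 4 * α) zero_le_one
    rw [show 2 * (2 * α) = 4 * α * 1 by ring, h3]
    linarith
  -- Radius `α / 2` gives `α`-separation: each center of a free `2α`-ball is within `α` of some `t ∈
  -- T`, so a sample in the `α`-ball around `t` lies in that `2α`-ball.
  obtain ⟨T, hTX, hTcov, hTcard⟩ := KnnPrm.exists_separated_cover hXpos hXfin hd (half_pos hα)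
    (S := {c | Metric.ball c (2 * α) ⊆ Xfree})
    fun c hc => (Metric.ball_subset_ball (by linarith)).trans hc
  have hTα : ∀ c ∈ T, Metric.ball c α ⊆ Xfree := fun c hc =>
    (Metric.ball_subset_ball (by linarith)).trans (hTX hc)
  have hmiss : T.card * Real.exp (-(KnnPrm.ballProb Xfree α * n)) ≤ γ / 2 := by
    -- A free `α`-ball is what shows `ballProb Xfree α ≤ 1`, so the case without one is separate.
    rcases T.eq_empty_or_nonempty with rfl | ⟨c, hc⟩
    · simpa using (half_pos hγ0).le
    refine KnnPrm.mul_exp_neg_le hd (KnnPrm.ballProb_pos hXpos hXfin hd hα) ?_ hγ0 hγ1 ?_ (by positivity)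
      ((le_max_left _ _).trans hsample) ((le_max_right _ _).trans hsample)
    · simpa using KnnPrm.card_mul_ballProb_le_one hXpos hXfin hd (r := α) (T := {c})
        (by simpa using hTα c hc) (by simp)
    -- The packing bound is at radius `α / 2`; doubling the radius costs the factor `2 ^ d`.
    · rw [show α = 2 * (α / 2) by ring, KnnPrm.ballProb_mul zero_le_two (half_pos hα).le]
      nlinarith [pow_pos (two_pos (α := ℝ)) d]
  let S : Set (KnnPrm.Conf d × KnnPrm.Conf d) := {z | dist z.1 z.2 < 2 * (2 * α)}
  have hS : MeasurableSet S := (isOpen_lt continuous_dist continuous_const).measurableSet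
  let M : KnnPrm.Conf d → Set Ω := fun c => {ω | ∀ i, N i ω ∉ Metric.ball c α}
  let C : Fin n → Set Ω := fun i =>
    {ω | K ≤ ((Finset.univ.erase i).filter fun j => (N i ω, N j ω) ∈ S).card}
  have hMm : ∀ c, MeasurableSet (M c) := fun c => by
    have : M c = ⋂ i, (N i ⁻¹' Metric.ball c α)ᶜ := by ext; simp [M]
    rw [this]
    exact MeasurableSet.iInter fun i => (hNmeas i measurableSet_ball).compl
  have hCm : ∀ i, MeasurableSet (C i) := fun i =>
    measurableSet_le measurable_const (KnnPrm.measurable_card_filter hNmeas hS i _)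
  have hMP : ∀ c ∈ T, P.real (M c) ≤ Real.exp (-(KnnPrm.ballProb Xfree α * n)) := fun c hc =>
    ENNReal.toReal_le_of_le_ofReal (Real.exp_nonneg _)
      (KnnPrm.measure_forall_notMem_ball_le hXpos hXfin hd hNmeas hNindep hNunif (hTα c hc))
  have hCP : ∀ i, P.real (C i) ≤ Real.exp (-L) := fun i =>
    ENNReal.toReal_le_of_le_ofReal (Real.exp_nonneg _)
      (KnnPrm.measure_le_card_filter_le hNmeas hNindep hS (KnnPrm.ballProb_nonneg (X := Xfree) (2 * (2 * α)))
        (fun x j => by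
          have := KnnPrm.measure_mem_ball_le hXpos hXfin hd (hNunif j) x (2 * (2 * α))
          rwa [show N j ⁻¹' Metric.ball x (2 * (2 * α)) = {ω | (x, N j ω) ∈ S} by
            ext; simp [S, dist_comm]] at this)
        hL hμ hμdef i _ (Finset.notMem_erase i _)
        (by
          rw [Finset.card_erase_of_mem (Finset.mem_univ i), Finset.card_univ, Fintype.card_fin,
            Nat.cast_pred (by omega)]
          exact hq))
  let B : Set Ω := (⋃ c ∈ T, M c) ∪ ⋃ i, C i
  have hBm : MeasurableSet B :=
    (T.measurableSet_biUnion fun c _ => hMm c).union (MeasurableSet.iUnion hCm)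
  have hB : P.real B ≤ γ := by
    have hexp : Real.exp (-L) = γ / (2 * n) := by
      rw [Real.exp_neg, hLdef, Real.exp_log (by positivity), inv_div]
    calc P.real B ≤ P.real (⋃ c ∈ T, M c) + P.real (⋃ i, C i) := measureReal_union_le _ _
      _ ≤ ∑ c ∈ T, P.real (M c) + ∑ i, P.real (C i) :=
        add_le_add (measureReal_biUnion_finset_le _ _) (measureReal_iUnion_fintype_le _)
      _ ≤ ∑ _c ∈ T, Real.exp (-(KnnPrm.ballProb Xfree α * n)) + ∑ _i : Fin n, Real.exp (-L) :=
        add_le_add (Finset.sum_le_sum hMP) (Finset.sum_le_sum fun i _ => hCP i)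
      _ ≤ γ / 2 + γ / 2 := by
        rw [Finset.sum_const, Finset.sum_const, nsmul_eq_mul, nsmul_eq_mul, Finset.card_univ,
          Fintype.card_fin, hexp]
        refine add_le_add hmiss (le_of_eq ?_)
        field_simp
      _ = γ := add_halves γ
  refine ⟨Bᶜ, hBm.compl, ?_, ?_⟩
  · rw [← ofReal_measureReal, probReal_compl_eq_one_sub hBm]
    exact ENNReal.ofReal_le_ofReal (by linarith)
  rintro ω hω near hnear s - g - ⟨σ, hσ⟩
  simp only [B, Set.mem_compl_iff, Set.mem_union, Set.mem_iUnion, not_or, not_exists] at hω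
  obtain ⟨hωM, hωC⟩ := hω
  refine KnnPrm.returnsFeasiblePath hK hnear (by positivity : 0 < 2 * α) ?_ ?_ σ hσ
  · intro c hc
    obtain ⟨t, ht, hct⟩ := hTcov c hc
    have := hωM t ht
    simp only [M, Set.mem_ofPred_eq, not_forall, not_not] at this
    obtain ⟨i, hi⟩ := this
    refine ⟨N i ω, Finset.mem_image_of_mem _ (Finset.mem_univ i), ?_⟩
    rw [Metric.mem_ball] at hi ⊢
    have := dist_triangle_right (N i ω) c t
    linarith
  · intro v hv
    obtain ⟨i, -, rfl⟩ := Finset.mem_image.1 hv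
    refine (KnnPrm.card_filter_erase_sampleSet_le (fun i => N i ω) i _).trans ?_
    have := hωC i
    simp only [C, S, Set.mem_ofPred_eq, not_le] at this
    convert this.le
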